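/- Let $n\in\mathbb N_0$ and let $B^n$ be the closed Euclidean unit ball of $\mathbb R^n$. Let $\operatorname{Conv}_c(\mathbb R^n)$ be the set of all functions $u:\mathbb R^n\to\mathbb R\cup\{+\infty\}$ that are convex, lower semicontinuous, proper ($u\not\equiv+\infty$) and coercive ($\lim_{|x|\to\infty}u(x)=+\infty$), and let $\operatorname{Conv}_s(\mathbb R^n)$ be the set of all convex, lower semicontinuous, proper $u:\mathbb R^n\to\mathbb R\cup\{+\infty\}$ that are super-coercive ($\lim_{|x|\to\infty}u(x)/|x|=+\infty$). Write $(u\mathbin{\Box}v)(x)=\inf_{x=y+z}(u(y)+v(z))$ for the infimal convolution, $u^*(y)=\sup_{x}(\langle x,y\rangle-u(x))$ for the convex conjugate, $\mathrm I^\infty_K$ for the function that is $0$ on $K$ and $+\infty$ outside $K$, and $n_\lambda(x)=\lambda^{-1}|x|$ for $\lambda>0$. A sequence $u_k$ epi-converges to $u$ if for every $x\in\mathbb R^n$ one has $\liminf_k u_k(x_k)\ge u(x)$ for every sequence $x_k\to x$, and $\limsup_k u_k(x_k)\le u(x)$ for some sequence $x_k\to x$. For $u,v\in\operatorname{Conv}_c(\mathbb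 R^n)$ define $$\delta(u,v)=\inf\{\lambda>0 : u\ge v\mathbin{\Box}(n_\lambda-\lambda)\ \text{and}\ v\ge u\mathbin{\Box}(n_\lambda-\lambda)\}\in[0,\infty],\qquad \inf\emptyset=\infty .$$ Then the following hold. 1. For all $u,v\in\operatorname{Conv}_c(\mathbb R^n)$, $$\delta(u,v)=\inf\{\lambda>0 : u^*\le v^*+\mathrm I^\infty_{\frac1\lambda B^n}+\lambda\ \text{and}\ v^*\le u^*+\mathrm I^\infty_{\frac1\lambda B^n}+\lambda\}=\inf\{\lambda>0 : \|u^*-v^*\|_{\infty,\frac1\lambda B^n}\le\lambda\},$$ where $\|u^*-v^*\|_{\infty,\frac1\lambda B^n}=\sup_{y\in\frac1\lambda B^n}|u^*(y)-v^*(y)|\in[0,\infty]$, with the convention $|\infty-\infty|=0$. 2. $\delta$ is a finite metric on $\operatorname{Conv}_c(\mathbb R^n)$: for all $u,v,w\in\operatorname{Conv}_c(\mathbb R^n)$ one has $\delta(u,v)<\infty$, $\delta(u,v)=0$ if and only if $u=v$, $\delta(u,v)=\delta(v,u)$, and $\delta(u,v)\le\delta(u,w)+\delta(w,v)$. 3.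 $\delta$ is invariant under joint translations of epigraphs: for all $u,v\in\operatorname{Conv}_c(\mathbb R^n)$, $x_0\in\mathbb R^n$ and $t_0\in\mathbb R$, the functions $u(\cdot-x_0)+t_0$ and $v(\cdot-x_0)+t_0$ belong to $\operatorname{Conv}_c(\mathbb R^n)$ and $\delta(u,v)=\delta(u(\cdot-x_0)+t_0,\,v(\cdot-x_0)+t_0)$. 4. If $u_k,u\in\operatorname{Conv}_c(\mathbb R^n)$ and $\delta(u_k,u)\to0$ as $k\to\infty$, then $u_k$ epi-converges to $u$. 5. If $u_k,u\in\operatorname{Conv}_s(\mathbb R^n)$ and $u_k$ epi-converges to $u$, then $\delta(u_k,u)\to0$ as $k\to\infty$. -/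

import Mathlib

open Filter Topology

noncomputable section

namespace ConvexFunctionMetric

/-- The Euclidean space `ℝⁿ`. -/
abbrev E (n : ℕ) : Type := EuclideanSpace ℝ (Fin n)

variable {n : ℕ}

/-- The epigraph `{(x, t) ∈ ℝⁿ × ℝ : u x ≤ t}`. -/
def epigraph (u : E n → EReal) : Set (E n × ℝ) := {p | u p.1 ≤ (p.2 : EReal)}

/-- `Conv(ℝⁿ)`: proper, lower semicontinuous, convex functions `ℝⁿ → ℝ ∪ {+∞}`. -/
structure IsConv (u : E n → EReal) : Prop where
  ne_bot : ∀ x, u x ≠ ⊥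
  exists_ne_top : ∃ x, u x ≠ ⊤
  lsc : LowerSemicontinuous u
  convex : Convex ℝ (epigraph u)

/-- `lim_{|x| → ∞} u(x) = +∞`. -/
def Coercive (u : E n → EReal) : Prop :=
  Tendsto u (comap (fun x : E n => ‖x‖) atTop) (𝓝 ⊤)

/-- `lim_{|x| → ∞} u(x) / |x| = +∞`. -/
def SuperCoercive (u : E n → EReal) : Prop :=
  Tendsto (fun x => u x / ((‖x‖ : ℝ) : EReal)) (comap (fun x : E n => ‖x‖) atTop) (𝓝 ⊤)

/-- The proper, lower semicontinuous, coercive, convex functions on `ℝⁿ`. -/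
def ConvC (n : ℕ) : Set (E n → EReal) := {u | IsConv u ∧ Coercive u}

/-- The proper, lower semicontinuous, super-coercive, convex functions on `ℝⁿ`. -/
def ConvS (n : ℕ) : Set (E n → EReal) := {u | IsConv u ∧ SuperCoercive u}

/-- The convex conjugate `u*(y) = sup_x (⟨x, y⟩ - u x)`. -/
def conj (u : E n → EReal) (y : E n) : EReal := ⨆ x : E n, ((inner ℝ x y : ℝ) : EReal) - u x

/-- The infimal convolution `(u □ v)(x) = inf_{x = y + z} (u y + v z)`. -/
def infConv (u v : E n → EReal) (x : E n) : EReal := ⨅ y : E n, u y + v (x - y)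

/-- The function `x ↦ |x| / r - r`. -/
def shiftedCone (r : ℝ) (x : E n) : EReal := ((r⁻¹ * ‖x‖ - r : ℝ) : EReal)

open Classical in
/-- The convex indicator function of a set: `0` on the set, `+∞` outside. -/
def indicatorTop (K : Set (E n)) (x : E n) : EReal := if x ∈ K then 0 else ⊤

/-- The Hausdorff-type distance: the infimum of all `r > 0` with `u ≥ v □ (|·| / r - r)` and
`v ≥ u □ (|·| / r - r)`. The infimum is taken in `[0, ∞]`, so it is `∞` if there is no such `r`. -/
def delta (u v : E n → EReal) : ENNReal :=
  ⨅ (r : ℝ) (_ : 0 < r)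
    (_ : (∀ x, infConv v (shiftedCone r) x ≤ u x) ∧ (∀ x, infConv u (shiftedCone r) x ≤ v x)),
    ENNReal.ofReal r

open Classical in
/-- `|a - b|` in `[0, ∞]` for extended reals `a, b`, where `|∞ - ∞| = 0`. -/
def absDiff (a b : EReal) : ENNReal := if a = b then 0 else (a - b).abs

/-- `sup_{x ∈ K} |f x - g x|`. -/
def supDist (K : Set (E n)) (f g : E n → EReal) : ENNReal := ⨆ x ∈ K, absDiff (f x) (g x)

/-- The function `x ↦ u (x - x₀) + t₀`, whose epigraph is that of `u` translated by `(x₀, t₀)`. -/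
def translate (x₀ : E n) (t₀ : ℝ) (u : E n → EReal) (x : E n) : EReal := u (x - x₀) + (t₀ : EReal)

/-- Epi-convergence of a sequence of functions. -/
def EpiTendsto (uk : ℕ → E n → EReal) (u : E n → EReal) : Prop :=
  ∀ x : E n,
    (∀ xk : ℕ → E n, Tendsto xk atTop (𝓝 x) → u x ≤ liminf (fun k => uk k (xk k)) atTop) ∧
    (∃ xk : ℕ → E n, Tendsto xk atTop (𝓝 x) ∧ limsup (fun k => uk k (xk k)) atTop ≤ u x)

end ConvexFunctionMetric

end

/-! Everything runs through `Majorizes r u v`: each point of the epigraph of `u` is matched, up to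
slack `r`, by a point of the epigraph of `v` at cost `r⁻¹` per unit of distance. The cones flatten
as `r` grows, which gives the triangle inequality. Finiteness follows from the linear growth of
coercive convex functions.

The conjugate description is duality: Cauchy–Schwarz bounds the cone term for `‖y‖ ≤ r⁻¹`
(`conj_le_of_majorizes`); conversely, a failed majorization puts an open downward cone below the
epigraph, and Hahn–Banach separates the two by an affine function of slope at most `r⁻¹`
(`majorizes_of_conj_le`).

For small `r` the cone is steep, so majorization compares nearby values only. With lower
semicontinuity this gives definiteness and epi-convergence (`exists_lt_of_majorizes`). For the
converse, a strict pointwise form of majorization persists locally under epi-convergence,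
compactness handles balls, and super-coercivity handles infinity. -/

namespace ConvexFunctionMetric

/-- The inequality `u ≥ v □ (|·| / r - r)`, written in terms of real upper bounds. -/
def Majorizes {n : ℕ} (r : ℝ) (u v : E n → EReal) : Prop :=
  ∀ (x : E n) (s : ℝ), u x ≤ s → ∀ ε > 0, ∃ (z : E n) (t : ℝ),
    v z ≤ t ∧ t + r⁻¹ * ‖x - z‖ < s + r + ε

variable {n : ℕ} {u v w : E n → EReal} {r q : ℝ}

/-! ### Majorization, symmetry, triangle inequality, translations -/

theorem infConv_le_iff_majorizes :
    (∀ x, infConv v (shiftedCone r) x ≤ u x) ↔ Majorizes r u v := by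
  constructor
  · intro h x s hs ε hε
    have h1 : infConv v (shiftedCone r) x < ((s + ε : ℝ) : EReal) :=
      ((h x).trans hs).trans_lt (EReal.coe_lt_coe_iff.2 (by linarith))
    obtain ⟨z, hz⟩ := iInf_lt_iff.1 h1
    refine ⟨z, ?_⟩
    unfold shiftedCone at hz
    induction hv : v z with
    | bot => exact ⟨s + r - r⁻¹ * ‖x - z‖, bot_le, by linarith⟩
    | top =>
      rw [hv, EReal.top_add_coe] at hz
      exact absurd hz not_top_lt
    | coe a =>
      rw [hv, ← EReal.coe_add, EReal.coe_lt_coe_iff] at hz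
      exact ⟨a, le_rfl, by linarith⟩
  · intro h x
    refine EReal.le_of_forall_lt_iff_le.1 fun b hb => ?_
    obtain ⟨s, hs, hsb⟩ := EReal.lt_iff_exists_real_btwn.1 hb
    rw [EReal.coe_lt_coe_iff] at hsb
    obtain ⟨z, t, hz, ht⟩ := h x s hs.le (b - s) (by linarith)
    refine (iInf_le _ z).trans ((add_le_add_left hz _).trans ?_)
    unfold shiftedCone
    rw [← EReal.coe_add, EReal.coe_le_coe_iff]
    linarith

theorem Majorizes.mono (h : Majorizes r u v) (hr : 0 < r) (hrq : r ≤ q) : Majorizes q u v := by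
  intro x s hs ε hε
  obtain ⟨z, t, hz, ht⟩ := h x s hs ε hε
  have h1 : q⁻¹ * ‖x - z‖ ≤ r⁻¹ * ‖x - z‖ := by gcongr
  exact ⟨z, t, hz, by linarith⟩

/-- The slope `(r + q)⁻¹` is at most `r⁻¹` and `q⁻¹`, so the two cone costs dominate the cost of the
direct step. -/
theorem Majorizes.trans (h : Majorizes r u w) (h' : Majorizes q w v) (hr : 0 < r) (hq : 0 < q) :
    Majorizes (r + q) u v := by
  intro x s hs ε hε
  obtain ⟨y, t, hy, ht⟩ := h x s hs (ε / 2) (by linarith)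
  obtain ⟨z, t', hz, ht'⟩ := h' y t hy (ε / 2) (by linarith)
  refine ⟨z, t', hz, ?_⟩
  have h1 : (r + q)⁻¹ * ‖x - z‖ ≤ (r + q)⁻¹ * ‖x - y‖ + (r + q)⁻¹ * ‖y - z‖ := by
    rw [← mul_add]
    have := norm_sub_le_norm_sub_add_norm_sub x y z
    gcongr
  have h2 : (r + q)⁻¹ * ‖x - y‖ ≤ r⁻¹ * ‖x - y‖ := by gcongr; linarith
  have h3 : (r + q)⁻¹ * ‖y - z‖ ≤ q⁻¹ * ‖y - z‖ := by gcongr; linarith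
  linarith

theorem translate_le_iff {x₀ x : E n} {t₀ s : ℝ} :
    translate x₀ t₀ u x ≤ s ↔ u (x - x₀) ≤ ((s - t₀ : ℝ) : EReal) := by
  unfold translate
  rw [EReal.coe_sub]
  exact (EReal.le_sub_iff_add_le (.inl (EReal.coe_ne_bot _)) (.inl (EReal.coe_ne_top _))).symm

theorem majorizes_translate (x₀ : E n) (t₀ : ℝ) :
    Majorizes r (translate x₀ t₀ u) (translate x₀ t₀ v) ↔ Majorizes r u v := by
  constructor
  · intro h x s hs ε hε
    obtain ⟨z, t, hz, ht⟩ := h (x + x₀) (s + t₀) (translate_le_iff.2 (by simpa using hs)) ε hε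
    refine ⟨z - x₀, t - t₀, translate_le_iff.1 hz, ?_⟩
    rw [show x - (z - x₀) = x + x₀ - z by abel]
    linarith
  · intro h x s hs ε hε
    obtain ⟨z, t, hz, ht⟩ := h (x - x₀) (s - t₀) (translate_le_iff.1 hs) ε hε
    refine ⟨z + x₀, t + t₀, translate_le_iff.2 (by simpa using hz), ?_⟩
    rw [show x - (z + x₀) = x - x₀ - z by abel]
    linarith

theorem delta_eq_iInf_majorizes (u v : E n → EReal) :
    delta u v = ⨅ (r : ℝ) (_ : 0 < r) (_ : Majorizes r u v ∧ Majorizes r v u),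
      ENNReal.ofReal r := by
  simp only [delta, infConv_le_iff_majorizes]

theorem delta_le (hr : 0 < r) (h : Majorizes r u v) (h' : Majorizes r v u) :
    delta u v ≤ ENNReal.ofReal r := by
  rw [delta_eq_iInf_majorizes]
  exact iInf_le_of_le r (iInf_le_of_le hr (iInf_le_of_le ⟨h, h'⟩ le_rfl))

theorem exists_majorizes_of_delta_lt {a : ENNReal} (h : delta u v < a) :
    ∃ r : ℝ, 0 < r ∧ ENNReal.ofReal r < a ∧ Majorizes r u v ∧ Majorizes r v u := by
  rw [delta_eq_iInf_majorizes] at h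
  simp only [iInf_lt_iff] at h
  obtain ⟨r, hr, hm, hlt⟩ := h
  exact ⟨r, hr, hlt, hm⟩

theorem majorizes_of_delta_lt (h : delta u v < ENNReal.ofReal r) :
    Majorizes r u v ∧ Majorizes r v u := by
  obtain ⟨q, hq, hlt, h1, h2⟩ := exists_majorizes_of_delta_lt h
  have hle : q ≤ r := (ENNReal.ofReal_lt_ofReal_iff_of_nonneg hq.le).1 hlt |>.le
  exact ⟨h1.mono hq hle, h2.mono hq hle⟩

theorem delta_comm (u v : E n → EReal) : delta u v = delta v u := by
  simp only [delta, and_comm]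

theorem delta_triangle (u v w : E n → EReal) : delta u v ≤ delta u w + delta w v := by
  refine le_of_forall_gt fun c hc => ?_
  obtain ⟨a, ha, b, hb, hab⟩ : ∃ a > delta u w, ∃ b > delta w v, a + b < c :=
    ENNReal.exists_add_lt_of_add_lt hc
  obtain ⟨r, hr, hra, h1, h2⟩ := exists_majorizes_of_delta_lt ha
  obtain ⟨q, hq, hqb, h3, h4⟩ := exists_majorizes_of_delta_lt hb
  refine (delta_le (add_pos hr hq) (h1.trans h3 hr hq) ?_).trans_lt ?_
  · rw [add_comm]; exact h4.trans h2 hq hr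
  · rw [ENNReal.ofReal_add hr.le hq.le]
    exact (add_le_add hra.le hqb.le).trans_lt hab

theorem delta_translate (x₀ : E n) (t₀ : ℝ) (u v : E n → EReal) :
    delta (translate x₀ t₀ u) (translate x₀ t₀ v) = delta u v := by
  simp only [delta_eq_iInf_majorizes, majorizes_translate]

theorem lowerSemicontinuous_iff_coe :
    LowerSemicontinuous u ↔ ∀ x (b : ℝ), (b : EReal) < u x → ∀ᶠ y in 𝓝 x, (b : EReal) < u y := by
  refine ⟨fun h x b hb => h x b hb, fun h x c hc => ?_⟩
  obtain ⟨b, hcb, hb⟩ := EReal.lt_iff_exists_real_btwn.1 hc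
  exact (h x b hb).mono fun y hy => hcb.trans hy

theorem coercive_iff_cobounded :
    Coercive u ↔ ∀ b : ℝ, ∀ᶠ x in Bornology.cobounded (E n), (b : EReal) < u x := by
  unfold Coercive
  rw [comap_norm_atTop, EReal.tendsto_nhds_top_iff_real]

theorem lt_translate_iff {x₀ x : E n} {t₀ b : ℝ} :
    (b : EReal) < translate x₀ t₀ u x ↔ ((b - t₀ : ℝ) : EReal) < u (x - x₀) := by
  rw [← not_le, ← not_le, translate_le_iff]

theorem IsConv.translate (hu : IsConv u) (x₀ : E n) (t₀ : ℝ) : IsConv (translate x₀ t₀ u) where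
  ne_bot x := by
    have := hu.ne_bot (x - x₀)
    simp [ConvexFunctionMetric.translate, this]
  exists_ne_top := by
    obtain ⟨x, hx⟩ := hu.exists_ne_top
    refine ⟨x + x₀, ?_⟩
    rw [ConvexFunctionMetric.translate, add_sub_cancel_right]
    exact (EReal.add_lt_top hx (EReal.coe_ne_top _)).ne
  lsc := by
    rw [lowerSemicontinuous_iff_coe]
    intro x b hb
    simp only [lt_translate_iff] at hb ⊢
    have hc : Tendsto (fun y : E n => y - x₀) (𝓝 x) (𝓝 (x - x₀)) :=
      (continuous_id.sub continuous_const).tendsto x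
    exact hc.eventually (hu.lsc _ _ hb)
  convex := by
    have : epigraph (ConvexFunctionMetric.translate x₀ t₀ u) =
        (fun p : E n × ℝ => (-x₀, -t₀) + p) ⁻¹' epigraph u := by
      ext p
      simp only [epigraph, Set.mem_ofPred_eq, Set.mem_preimage, translate_le_iff]
      rw [Prod.fst_add, Prod.snd_add, neg_add_eq_sub, neg_add_eq_sub]
    rw [this]
    exact hu.convex.translate_preimage_right _

theorem translate_mem_convC (hu : u ∈ ConvC n) (x₀ : E n) (t₀ : ℝ) :
    translate x₀ t₀ u ∈ ConvC n := by
  refine ⟨hu.1.translate x₀ t₀, coercive_iff_cobounded.2 fun b => ?_⟩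
  simp only [lt_translate_iff]
  have h := coercive_iff_cobounded.1 hu.2 (b - t₀)
  have hc : Tendsto (fun x : E n => x - x₀) (Bornology.cobounded _) (Bornology.cobounded _) := 
    tendsto_sub_const_cobounded x₀
  exact hc.eventually h

/-! ### Growth of coercive convex functions and finiteness -/

theorem IsConv.exists_le_coe (hu : IsConv u) : ∃ (a : E n) (t : ℝ), u a ≤ t := by
  obtain ⟨a, ha⟩ := hu.exists_ne_top
  exact ⟨a, (u a).toReal, EReal.le_coe_toReal ha⟩

theorem IsConv.le_on_segment (hu : IsConv u) {x y : E n} {s t τ : ℝ} (hx : u x ≤ s) (hy : u y ≤ t)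
    (h0 : 0 ≤ τ) (h1 : τ ≤ 1) :
    u ((1 - τ) • x + τ • y) ≤ (((1 - τ) * s + τ * t : ℝ) : EReal) :=
  hu.convex (x := (x, s)) hx (y := (y, t)) hy (sub_nonneg.2 h1) h0 (by ring)

/-- A convex function that is large on a sphere grows linearly outside of it. -/
theorem IsConv.le_of_le_on_sphere (hu : IsConv u) {a x : E n} {R M s t : ℝ} (hR : 0 < R)
    (ha : u a ≤ t) (hM : ∀ y, ‖y - a‖ = R → (M : EReal) ≤ u y) (hx : R ≤ ‖x - a‖) (hs : u x ≤ s) :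
    t + (M - t) / R * ‖x - a‖ ≤ s := by
  have hpos : 0 < ‖x - a‖ := hR.trans_le hx
  -- This weight puts the convex combination of `a` and `x` on the sphere of radius `R` about `a`.
  set τ := R / ‖x - a‖ with hτ
  have h1 := hu.le_on_segment ha hs (τ := τ) (by positivity) ((div_le_one hpos).2 hx)
  have h2 := hM ((1 - τ) • a + τ • x) (by
    rw [show (1 - τ) • a + τ • x - a = τ • (x - a) by module, norm_smul, hτ, Real.norm_eq_abs,
      abs_of_pos (by positivity)]
    field_simp)
  have h3 := EReal.coe_le_coe_iff.1 (h2.trans h1)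
  have h4 : (M - t) / R ≤ (s - t) / ‖x - a‖ := by
    rw [div_le_div_iff₀ hR hpos]
    rw [hτ] at h3
    field_simp at h3
    nlinarith
  rw [le_div_iff₀ hpos] at h4
  linarith

theorem exists_lower_bound (hu : u ∈ ConvC n) : ∃ m : ℝ, ∀ x, (m : EReal) ≤ u x := by
  obtain ⟨R, -, hR⟩ := hasBasis_cobounded_norm.eventually_iff.1 (coercive_iff_cobounded.1 hu.2 0)
  -- The radius `|R|` keeps the ball nonempty when `R` is negative.
  obtain ⟨a, -, ha⟩ := LowerSemicontinuousOn.exists_isMinOn (s := Metric.closedBall (0 : E n) |R|)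
    ⟨0, by simp⟩ (isCompact_closedBall _ _) (hu.1.lsc.lowerSemicontinuousOn _)
  obtain ⟨m, -, hm⟩ := EReal.lt_iff_exists_real_btwn.1 (bot_lt_iff_ne_bot.2 (hu.1.ne_bot a))
  refine ⟨min m 0, fun x => ?_⟩
  rcases le_total R ‖x‖ with h | h
  · exact (EReal.coe_le_coe_iff.2 (min_le_right _ _)).trans (hR h).le
  · exact (EReal.coe_le_coe_iff.2 (min_le_left _ _)).trans
      (hm.le.trans (ha (by simpa using h.trans (le_abs_self R))))

/-- Coercivity makes `u` at least `t + 1` on a sphere of radius `S` about a point where `u ≤ t`;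
convexity then forces slope `S⁻¹` outside, and the global lower bound covers the inside. -/
theorem exists_linear_lower_bound (hu : u ∈ ConvC n) :
    ∃ c > 0, ∃ d : ℝ, ∀ (x : E n) (s : ℝ), u x ≤ s → c * ‖x‖ ≤ s + d := by
  obtain ⟨a, t, ha⟩ := hu.1.exists_le_coe
  obtain ⟨m, hm⟩ := exists_lower_bound hu
  obtain ⟨R, -, hR⟩ := hasBasis_cobounded_norm.eventually_iff.1
    (coercive_iff_cobounded.1 hu.2 (t + 1))
  set S := |R| + ‖a‖ + 1 with hS
  have hSpos : 0 < S := by positivity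
  have key : ∀ (x : E n) (s : ℝ), u x ≤ s → S⁻¹ * ‖x - a‖ ≤ s + (|t| + |m| + 1) := by
    intro x s hs
    rcases le_total S ‖x - a‖ with h | h
    · have := hu.1.le_of_le_on_sphere (M := t + 1) hSpos ha (fun y hy => (hR ?_).le) h hs
      · rw [add_sub_cancel_left, one_div] at this
        have := neg_abs_le t
        have := abs_nonneg m
        linarith
      · have := norm_sub_le y a
        have := le_abs_self R
        show R ≤ ‖y‖
        linarith
    · have h1 : S⁻¹ * ‖x - a‖ ≤ 1 := by
        rw [inv_mul_le_iff₀ hSpos]; linarith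
      have h2 := EReal.coe_le_coe_iff.1 ((hm x).trans hs)
      have := neg_abs_le m
      have := abs_nonneg t
      linarith
  refine ⟨S⁻¹, by positivity, |t| + |m| + 1 + S⁻¹ * ‖a‖, fun x s hs => ?_⟩
  have h1 : S⁻¹ * ‖x‖ ≤ S⁻¹ * ‖x - a‖ + S⁻¹ * ‖a‖ := by
    rw [← mul_add]
    gcongr
    simpa using norm_add_le (x - a) a
  linarith [key x s hs]

/-- One epigraph point `(b, t)` of `v` serves every `x`: a large `r` makes the cone at `b` flatter
than the linear lower bound of `u` and low enough to stay below it. -/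
theorem exists_majorizes (hu : u ∈ ConvC n) (hv : v ∈ ConvC n) :
    ∃ r : ℝ, 0 < r ∧ Majorizes r u v := by
  obtain ⟨c, hc, d, h⟩ := exists_linear_lower_bound hu
  obtain ⟨b, t, hb⟩ := hv.1.exists_le_coe
  set r := max c⁻¹ (d + t + c * ‖b‖) with hr
  have hr0 : 0 < r := lt_max_of_lt_left (inv_pos.2 hc)
  have hrc : r⁻¹ ≤ c := inv_le_of_inv_le₀ hc (le_max_left _ _)
  refine ⟨r, hr0, fun x s hs ε hε => ⟨b, t, hb, ?_⟩⟩
  have h1 : r⁻¹ * ‖x - b‖ ≤ c * (‖x‖ + ‖b‖) :=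
    mul_le_mul hrc (norm_sub_le _ _) (norm_nonneg _) hc.le
  have h2 : d + t + c * ‖b‖ ≤ r := le_max_right _ _
  linarith [h x s hs]

theorem delta_ne_top (hu : u ∈ ConvC n) (hv : v ∈ ConvC n) : delta u v ≠ ⊤ := by
  obtain ⟨r, hr, h⟩ := exists_majorizes hu hv
  obtain ⟨q, hq, h'⟩ := exists_majorizes hv hu
  exact ne_top_of_le_ne_top ENNReal.ofReal_ne_top
    (delta_le (lt_max_of_lt_left hr) (h.mono hr (le_max_left r q)) (h'.mono hq (le_max_right r q)))

/-! ### Small parameters and definiteness -/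

/-- If `u` is lower semicontinuous and bounded below, then strict lower bounds of `u` at a point
carry over to nearby values of all functions that majorize `u` with small parameter. -/
theorem exists_lt_of_majorizes (hu : LowerSemicontinuous u) {m b : ℝ} (hm : ∀ x, (m : EReal) ≤ u x)
    {x : E n} (hb : (b : EReal) < u x) :
    ∃ r > 0, ∃ δ > 0, ∀ w : E n → EReal, Majorizes r w u → ∀ y, dist y x < δ →
      (b : EReal) < w y := by
  obtain ⟨c, hbc, hc⟩ := EReal.lt_iff_exists_real_btwn.1 hb
  rw [EReal.coe_lt_coe_iff] at hbc
  obtain ⟨ρ, hρ, hball⟩ := Metric.eventually_nhds_iff.1 (hu x c hc)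
  set A := |b - m| + 2 with hA
  have hApos : 0 < A := by positivity
  -- With slack `ε = r`, a matching `z` within `ρ` of `x` would need `c < b + 2 * r`; one farther
  -- away would pay a cone cost of at least `A`, exceeding `b - m + 2 * r`.
  set r := min (min 1 ((c - b) / 2)) (ρ / 2 / A) with hr
  have hr0 : 0 < r := by
    have : 0 < c - b := by linarith
    positivity
  have hr1 : r ≤ 1 := (min_le_left _ _).trans (min_le_left _ _)
  have hr2 : r ≤ (c - b) / 2 := (min_le_left _ _).trans (min_le_right _ _)
  have hr3 : A ≤ r⁻¹ * (ρ / 2) := by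
    rw [← div_eq_inv_mul, le_div_iff₀ hr0, mul_comm, ← le_div_iff₀ hApos]
    exact min_le_right _ _
  refine ⟨r, hr0, ρ / 2, by positivity, fun w hw y hy => ?_⟩
  by_contra! hle
  obtain ⟨z, t, hz, ht⟩ := hw y b hle r hr0
  rcases lt_or_ge (dist z x) ρ with hzx | hzx
  · have h1 : c < t := EReal.coe_lt_coe_iff.1 ((hball hzx).trans_le hz)
    have h2 : 0 ≤ r⁻¹ * ‖y - z‖ := by positivity
    linarith
  · have h1 : m ≤ t := EReal.coe_le_coe_iff.1 ((hm z).trans hz)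
    have h2 : ρ / 2 ≤ ‖y - z‖ := by
      have := dist_triangle_left z x y
      rw [← dist_eq_norm]
      linarith
    have h3 : r⁻¹ * (ρ / 2) ≤ r⁻¹ * ‖y - z‖ := by gcongr
    have := le_abs_self (b - m)
    linarith

theorem le_of_delta_eq_zero (hu : u ∈ ConvC n) (h : delta u v = 0) (x : E n) : u x ≤ v x := by
  obtain ⟨m, hm⟩ := exists_lower_bound hu
  refine EReal.ge_of_forall_gt_iff_ge.1 fun b hb => ?_
  obtain ⟨r, hr, δ, hδ, H⟩ := exists_lt_of_majorizes hu.1.lsc hm hb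
  exact (H v (majorizes_of_delta_lt (h ▸ ENNReal.ofReal_pos.2 hr)).2 x (by simpa using hδ)).le

theorem delta_self (u : E n → EReal) : delta u u = 0 := by
  refine nonpos_iff_eq_zero.1 (le_of_forall_gt fun c hc => ?_)
  obtain ⟨r, hr, hrc⟩ := ENNReal.lt_iff_exists_nnreal_btwn.1 hc
  have hr' : (0 : ℝ) < r := by exact_mod_cast hr
  have h : Majorizes (r : ℝ) u u := fun x s hs ε hε => ⟨x, s, hs, by simp; linarith⟩
  exact (delta_le hr' h h).trans_lt (by simpa using hrc)

theorem delta_eq_zero_iff (hu : u ∈ ConvC n) (hv : v ∈ ConvC n) : delta u v = 0 ↔ u = v :=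
  ⟨fun h => funext fun x => (le_of_delta_eq_zero hu h x).antisymm
    (le_of_delta_eq_zero hv (delta_comm u v ▸ h) x), fun h => h ▸ delta_self u⟩

/-! ### Majorization through conjugates -/

theorem conj_le_iff {y : E n} {s : ℝ} :
    conj u y ≤ s ↔ ∀ (x : E n) (t : ℝ), u x ≤ t → inner ℝ x y - t ≤ s := by
  unfold conj
  rw [iSup_le_iff]
  refine forall_congr' fun x => ?_
  induction hx : u x with
  | bot =>
    refine iff_of_false (by simp) fun h => ?_
    have := h (inner ℝ x y - s - 1) bot_le
    linarith
  | top => simp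
  | coe a =>
    rw [← EReal.coe_sub, EReal.coe_le_coe_iff]
    exact ⟨fun h t ht => by have := EReal.coe_le_coe_iff.1 ht; linarith, fun h => h a le_rfl⟩

theorem IsConv.conj_ne_bot (hu : IsConv u) (y : E n) : conj u y ≠ ⊥ := by
  intro h
  obtain ⟨a, t, ha⟩ := hu.exists_le_coe
  have := conj_le_iff.1 ((h.trans_le bot_le).trans le_rfl : conj u y ≤
    ((inner ℝ a y - t - 1 : ℝ) : EReal)) a t ha
  linarith

theorem conj_le_of_majorizes (h : Majorizes r u v) {y : E n} (hy : ‖y‖ ≤ r⁻¹) {s : ℝ}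
    (hs : conj v y ≤ s) : conj u y ≤ ((s + r : ℝ) : EReal) := by
  rw [conj_le_iff] at hs ⊢
  intro x t hx
  refine le_of_forall_pos_le_add fun ε hε => ?_
  obtain ⟨z, t', hz, ht'⟩ := h x t hx ε hε
  have h1 := hs z t' hz
  have h2 : inner ℝ (x - z) y ≤ r⁻¹ * ‖x - z‖ := by
    rw [mul_comm]
    exact (real_inner_le_norm _ _).trans (by gcongr)
  rw [inner_sub_left] at h2
  linarith

/-- A nonvertical affine function separating the epigraph of `v` from a downward cone. -/
theorem exists_affine_between (hv : IsConv v) (hr : 0 < r) {x : E n} {c : ℝ}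
    (h : ∀ (z : E n) (t : ℝ), v z ≤ t → c ≤ t + r⁻¹ * ‖x - z‖) :
    ∃ (y : E n) (σ : ℝ), (∀ (z : E n) (t : ℝ), v z ≤ t → σ + inner ℝ z y ≤ t) ∧
      ∀ (z : E n) (t : ℝ), t + r⁻¹ * ‖x - z‖ < c → t < σ + inner ℝ z y := by
  set A : Set (E n × ℝ) := {p | p.2 + r⁻¹ * ‖x - p.1‖ < c} with hA
  have hAopen : IsOpen A := isOpen_lt (by fun_prop) continuous_const
  have hAconv : Convex ℝ A := by
    intro p hp q hq a b ha hb hab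
    have hp' : p.2 + r⁻¹ * ‖x - p.1‖ < c := hp
    have hq' : q.2 + r⁻¹ * ‖x - q.1‖ < c := hq
    show a * p.2 + b * q.2 + r⁻¹ * ‖x - (a • p.1 + b • q.1)‖ < c
    have h1 : ‖x - (a • p.1 + b • q.1)‖ ≤ a * ‖x - p.1‖ + b * ‖x - q.1‖ := by
      rw [show x - (a • p.1 + b • q.1) = a • (x - p.1) + b • (x - q.1) by
        conv_lhs => rw [← one_smul ℝ x, ← hab]
        module]
      refine (norm_add_le _ _).trans_eq ?_
      rw [norm_smul, norm_smul, Real.norm_of_nonneg ha, Real.norm_of_nonneg hb]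
    have h2 : r⁻¹ * ‖x - (a • p.1 + b • q.1)‖ ≤ r⁻¹ * (a * ‖x - p.1‖ + b * ‖x - q.1‖) := by
      gcongr
    have h3 : a * (p.2 + r⁻¹ * ‖x - p.1‖) + b * (q.2 + r⁻¹ * ‖x - q.1‖) < c := by
      have := convex_Iio c hp' hq' ha hb hab
      simpa using this
    linarith
  have hdisj : Disjoint A (epigraph v) := by
    rw [Set.disjoint_left]
    exact fun p hp hq => not_lt.2 (h p.1 p.2 hq) hp
  obtain ⟨f, σ, hfA, hfv⟩ := geometric_hahn_banach_open hAconv hAopen hv.convex hdisj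
  set β := f (0, 1) with hβ
  set g : E n →L[ℝ] ℝ := f.comp (ContinuousLinearMap.inl ℝ (E n) ℝ) with hg
  set p := (InnerProductSpace.toDual ℝ (E n)).symm g with hp
  have hf : ∀ z t, f (z, t) = inner ℝ z p + t * β := by
    intro z t
    have h1 : inner ℝ z p = f (z, 0) := by
      rw [real_inner_comm, hp, InnerProductSpace.toDual_symm_apply]
      rfl
    rw [h1, hβ, ← smul_eq_mul, ← map_smul, ← map_add]
    simp
  -- Above a point `b` where `v` is finite, the cone contains a point strictly lower than one of the
  -- epigraph, so the separating hyperplane is not vertical.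
  have hβpos : 0 < β := by
    obtain ⟨b, t, hb⟩ := hv.exists_le_coe
    have h1 := hfv (b, t) hb
    have h2 := hfA (b, min (t - 1) (c - r⁻¹ * ‖x - b‖ - 1)) (by
      show _ + _ < c
      have := min_le_right (t - 1) (c - r⁻¹ * ‖x - b‖ - 1)
      dsimp only
      linarith)
    rw [hf] at h1 h2
    have h3 := min_le_left (t - 1) (c - r⁻¹ * ‖x - b‖ - 1)
    by_contra! hneg
    nlinarith
  have hinner : ∀ z, inner ℝ z (-β⁻¹ • p) = -(inner ℝ z p / β) := by
    intro z
    rw [inner_smul_right]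
    field_simp
  refine ⟨-β⁻¹ • p, σ / β, fun z t hz => ?_, fun z t hz => ?_⟩
  · have h1 := hfv (z, t) hz
    rw [hf] at h1
    rw [hinner, ← sub_eq_add_neg, ← sub_div, div_le_iff₀ hβpos]
    linarith
  · have h1 := hfA (z, t) hz
    rw [hf] at h1
    rw [hinner, ← sub_eq_add_neg, ← sub_div, lt_div_iff₀ hβpos]
    linarith

/-- Along `-y` the affine function falls at rate `‖y‖` and the cone at rate `r⁻¹`; were the former
larger, the affine function would end up below the cone. The step length `T` is tuned so that the
excess drop `T * D` equals `|K|`. -/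
theorem norm_le_of_cone_le_affine {x y : E n} {c σ : ℝ} (hr : 0 < r)
    (h : ∀ (z : E n) (t : ℝ), t + r⁻¹ * ‖x - z‖ < c → t < σ + inner ℝ z y) : ‖y‖ ≤ r⁻¹ := by
  by_contra! hy
  have hy0 : 0 < ‖y‖ := (inv_pos.2 hr).trans hy
  set D := ‖y‖ * (‖y‖ - r⁻¹) with hD
  have hDpos : 0 < D := mul_pos hy0 (by linarith)
  set K := σ + inner ℝ x y - c + 1 with hK
  set T := |K| / D with hT
  have hT0 : 0 ≤ T := by positivity
  have h1 := h (x - T • y) (c - 1 - r⁻¹ * ‖T • y‖) (by rw [sub_sub_cancel]; linarith)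
  rw [inner_sub_left, inner_smul_left, real_inner_self_eq_norm_sq, norm_smul,
    Real.norm_of_nonneg hT0] at h1
  have h2 : T * D = |K| := by rw [hT]; field_simp
  have h3 : T * D = T * ‖y‖ ^ 2 - r⁻¹ * (T * ‖y‖) := by rw [hD]; ring
  have h4 := le_abs_self K
  simp only [conj_trivial] at h1
  linarith

theorem majorizes_of_conj_le (hv : IsConv v) (hr : 0 < r)
    (h : ∀ y : E n, ‖y‖ ≤ r⁻¹ → ∀ s : ℝ, conj v y ≤ s → conj u y ≤ ((s + r : ℝ) : EReal)) :
    Majorizes r u v := by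
  intro x s hs ε hε
  by_contra! hcon
  obtain ⟨y, σ, h1, h2⟩ := exists_affine_between hv hr hcon
  have h3 := h y (norm_le_of_cone_le_affine hr h2) (-σ)
    (conj_le_iff.2 fun z t hz => by linarith [h1 z t hz])
  have h4 := conj_le_iff.1 h3 x s hs
  have h5 := h2 x (s + r + ε / 2) (by simp; linarith)
  linarith

theorem majorizes_iff_conj_le (hv : IsConv v) (hr : 0 < r) :
    Majorizes r u v ↔
      ∀ y : E n, ‖y‖ ≤ r⁻¹ → ∀ s : ℝ, conj v y ≤ s → conj u y ≤ ((s + r : ℝ) : EReal) :=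
  ⟨fun h _ hy _ hs => conj_le_of_majorizes h hy hs, majorizes_of_conj_le hv hr⟩

theorem le_add_coe_iff {a b : EReal} (hb : b ≠ ⊥) :
    a ≤ b + r ↔ ∀ s : ℝ, b ≤ s → a ≤ ((s + r : ℝ) : EReal) := by
  induction b with
  | bot => exact absurd rfl hb
  | top => simp
  | coe b =>
    refine ⟨fun h s hs => h.trans ?_, fun h => by simpa using h b le_rfl⟩
    rw [EReal.coe_add]
    gcongr

theorem majorizes_iff_conj_le_indicatorTop (hv : IsConv v) (hr : 0 < r) :
    Majorizes r u v ↔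
      ∀ y, conj u y ≤ conj v y + indicatorTop (Metric.closedBall 0 (1 / r)) y + (r : EReal) := by
  rw [majorizes_iff_conj_le hv hr]
  refine forall_congr' fun y => ?_
  unfold indicatorTop
  rw [mem_closedBall_zero_iff, one_div]
  split_ifs with hy
  · rw [add_zero, le_add_coe_iff (hv.conj_ne_bot y)]
    simp [hy]
  · simp [hy, EReal.add_top_of_ne_bot (hv.conj_ne_bot y)]

theorem absDiff_le_iff {a b : EReal} (ha : a ≠ ⊥) (hb : b ≠ ⊥) (hr : 0 ≤ r) :
    absDiff a b ≤ ENNReal.ofReal r ↔ a ≤ b + r ∧ b ≤ a + r := by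
  unfold absDiff
  induction a with
  | bot => exact absurd rfl ha
  | top =>
    induction b with
    | bot => exact absurd rfl hb
    | top => simp
    | coe b => simp [← EReal.coe_add]
  | coe a =>
    induction b with
    | bot => exact absurd rfl hb
    | top => simp [← EReal.coe_add]
    | coe b =>
      have h1 : (a : EReal) ≤ b + r ∧ (b : EReal) ≤ a + r ↔ |a - b| ≤ r := by
        rw [← EReal.coe_add, ← EReal.coe_add, EReal.coe_le_coe_iff, EReal.coe_le_coe_iff,
          abs_sub_le_iff, sub_le_iff_le_add', sub_le_iff_le_add']
      rw [h1]
      split_ifs with h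
      · rw [EReal.coe_eq_coe_iff] at h
        simp [h, hr]
      · rw [← EReal.coe_sub, EReal.abs_def, ENNReal.ofReal_le_ofReal_iff hr]

theorem supDist_conj_le_iff (hu : IsConv u) (hv : IsConv v) (hr : 0 < r) :
    supDist (Metric.closedBall 0 (1 / r)) (conj u) (conj v) ≤ ENNReal.ofReal r ↔
      Majorizes r u v ∧ Majorizes r v u := by
  simp only [supDist, iSup_le_iff, majorizes_iff_conj_le hv hr, majorizes_iff_conj_le hu hr,
    mem_closedBall_zero_iff, one_div, ← forall_and]
  refine forall₂_congr fun y hy => ?_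
  rw [absDiff_le_iff (hu.conj_ne_bot y) (hv.conj_ne_bot y) hr.le,
    le_add_coe_iff (hv.conj_ne_bot y), le_add_coe_iff (hu.conj_ne_bot y)]
  rw [forall_and]

theorem delta_eq_iInf_conj_le (hu : IsConv u) (hv : IsConv v) :
    delta u v = ⨅ (r : ℝ) (_ : 0 < r)
      (_ : (∀ y, conj u y ≤
            conj v y + indicatorTop (Metric.closedBall 0 (1 / r)) y + (r : EReal)) ∧
          (∀ y, conj v y ≤
            conj u y + indicatorTop (Metric.closedBall 0 (1 / r)) y + (r : EReal))),
      ENNReal.ofReal r := by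
  rw [delta_eq_iInf_majorizes]
  refine iInf_congr fun r => iInf_congr fun hr => ?_
  rw [majorizes_iff_conj_le_indicatorTop hv hr, majorizes_iff_conj_le_indicatorTop hu hr]

theorem delta_eq_iInf_supDist_le (hu : IsConv u) (hv : IsConv v) :
    delta u v = ⨅ (r : ℝ) (_ : 0 < r)
      (_ : supDist (Metric.closedBall 0 (1 / r)) (conj u) (conj v) ≤ ENNReal.ofReal r),
      ENNReal.ofReal r := by
  rw [delta_eq_iInf_majorizes]
  refine iInf_congr fun r => iInf_congr fun hr => ?_
  rw [supDist_conj_le_iff hu hv hr]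

/-! ### From convergence in `delta` to epi-convergence -/

variable {uk : ℕ → E n → EReal}

theorem eventually_majorizes (h : Tendsto (fun k => delta (uk k) u) atTop (𝓝 0)) (hr : 0 < r) :
    ∀ᶠ k in atTop, Majorizes r (uk k) u ∧ Majorizes r u (uk k) :=
  (h.eventually (gt_mem_nhds (ENNReal.ofReal_pos.2 hr))).mono fun _ hk => majorizes_of_delta_lt hk

theorem exists_tendsto_zero_majorizes (huk : ∀ k, uk k ∈ ConvC n) (hu : u ∈ ConvC n)
    (h : Tendsto (fun k => delta (uk k) u) atTop (𝓝 0)) :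
    ∃ ρ : ℕ → ℝ, Tendsto ρ atTop (𝓝 0) ∧ ∀ k, 0 < ρ k ∧
      Majorizes (ρ k) (uk k) u ∧ Majorizes (ρ k) u (uk k) := by
  -- The extra term makes the parameter positive and strictly larger than the distance, at which the
  -- infimum need not be attained.
  refine ⟨fun k => (delta (uk k) u).toReal + 1 / ((k : ℝ) + 1), ?_, fun k => ?_⟩
  · have h1 := (ENNReal.tendsto_toReal ENNReal.zero_ne_top).comp h
    simpa using h1.add tendsto_one_div_add_atTop_nhds_zero_nat
  · have hpos : (0 : ℝ) < 1 / ((k : ℝ) + 1) := by positivity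
    refine ⟨by positivity, majorizes_of_delta_lt ?_⟩
    rw [ENNReal.lt_ofReal_iff_toReal_lt (delta_ne_top (huk k) hu)]
    linarith

theorem epiTendsto_of_tendsto_delta (huk : ∀ k, uk k ∈ ConvC n) (hu : u ∈ ConvC n)
    (h : Tendsto (fun k => delta (uk k) u) atTop (𝓝 0)) : EpiTendsto uk u := by
  obtain ⟨m, hm⟩ := exists_lower_bound hu
  refine fun x => ⟨fun xk hxk => ?_, ?_⟩
  · refine EReal.ge_of_forall_gt_iff_ge.1 fun b hb => ?_
    obtain ⟨r, hr, δ, hδ, H⟩ := exists_lt_of_majorizes hu.1.lsc hm hb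
    refine le_liminf_of_le (h := ?_)
    filter_upwards [eventually_majorizes h hr, Metric.tendsto_nhds.1 hxk δ hδ] with k h1 h2
    exact (H _ h1.1 _ h2).le
  · by_cases hx : u x = ⊤
    · exact ⟨fun _ => x, tendsto_const_nhds, hx ▸ le_top⟩
    set a := (u x).toReal with ha
    have hxa : u x = a := (EReal.coe_toReal hx (hu.1.ne_bot x)).symm
    obtain ⟨ρ, hρ, hmaj⟩ := exists_tendsto_zero_majorizes huk hu h
    choose z t hz ht using fun k => (hmaj k).2.2 x a hxa.le (ρ k) (hmaj k).1
    -- Matching `(z k, t k)` back into the epigraph of `u` bounds `t k` below. The cone cost `(ρ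
    -- k)⁻¹ * ‖x - z k‖` is then bounded, which forces `z k` to converge to `x`.
    have hlow : ∀ k, m ≤ t k + 2 * ρ k := by
      intro k
      obtain ⟨y, s, hy, hs⟩ := (hmaj k).2.1 (z k) (t k) (hz k) (ρ k) (hmaj k).1
      have h1 : m ≤ s := EReal.coe_le_coe_iff.1 ((hm y).trans hy)
      have h2 : 0 ≤ (ρ k)⁻¹ * ‖z k - y‖ :=
        mul_nonneg (inv_nonneg.2 (hmaj k).1.le) (norm_nonneg _)
      linarith
    have hbound : ∀ k, dist (z k) x ≤ ρ k * (a - m + 4 * ρ k) := by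
      intro k
      rw [dist_comm, dist_eq_norm, ← inv_mul_le_iff₀ (hmaj k).1]
      linarith [ht k, hlow k]
    refine ⟨z, tendsto_iff_dist_tendsto_zero.2 (squeeze_zero (fun _ => dist_nonneg) hbound ?_), ?_⟩
    · simpa using hρ.mul ((hρ.const_mul 4).const_add (a - m))
    · have h1 : Tendsto (fun k => ((a + 2 * ρ k : ℝ) : EReal)) atTop (𝓝 (a : EReal)) := by
        refine (continuous_coe_real_ereal.tendsto a).comp ?_
        simpa using (hρ.const_mul 2).const_add a
      rw [hxa, ← h1.limsup_eq]
      refine limsup_le_limsup (Eventually.of_forall fun k => (hz k).trans ?_)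
      have h2 : 0 ≤ (ρ k)⁻¹ * ‖x - z k‖ :=
        mul_nonneg (inv_nonneg.2 (hmaj k).1.le) (norm_nonneg _)
      rw [EReal.coe_le_coe_iff]
      linarith [ht k]

/-! ### Local uniformity of epi-convergence -/

theorem eventually_prod_lt_of_epiTendsto (h : EpiTendsto uk u) {x : E n} {b : EReal}
    (hb : b < u x) : ∀ᶠ p in atTop ×ˢ 𝓝 x, b < uk p.1 p.2 := by
  by_contra hcon
  obtain ⟨ns, hns, hlt⟩ := exists_seq_forall_of_frequently (not_eventually.1 hcon)
  obtain ⟨φ, hφ, hψ⟩ := strictMono_subseq_of_tendsto_atTop (tendsto_fst.comp hns)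
  set ψ : ℕ → ℕ := (Prod.fst ∘ ns) ∘ φ with hψdef
  set y : ℕ → E n := (Prod.snd ∘ ns) ∘ φ with hy
  have hylim : Tendsto y atTop (𝓝 x) := (tendsto_snd.comp hns).comp hφ.tendsto_atTop
  -- The counterexamples exist only at the indices `ψ m`; filling the gaps with `x` gives a full
  -- sequence to which the liminf condition applies.
  set xk : ℕ → E n := Function.extend ψ y fun _ => x with hxk
  have hxklim : Tendsto xk atTop (𝓝 x) := by
    intro U hU
    obtain ⟨N, hN⟩ := eventually_atTop.1 (hylim hU)
    refine eventually_atTop.2 ⟨ψ N, fun k hk => ?_⟩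
    by_cases hex : ∃ m, ψ m = k
    · obtain ⟨m, rfl⟩ := hex
      show xk (ψ m) ∈ U
      rw [hxk, hψ.injective.extend_apply]
      exact hN m (hψ.le_iff_le.1 hk)
    · show xk k ∈ U
      rw [hxk, Function.extend_apply' _ _ _ hex]
      exact mem_of_mem_nhds hU
  have h1 := eventually_lt_of_lt_liminf (hb.trans_le ((h x).1 xk hxklim))
  obtain ⟨m, hm⟩ := (hψ.tendsto_atTop.eventually h1).exists
  rw [hxk, hψ.injective.extend_apply] at hm
  exact hlt (φ m) hm

theorem exists_recovery_of_epiTendsto (h : EpiTendsto uk u) {z : E n} {t s : ℝ} (hz : u z ≤ t)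
    (hts : t < s) : ∃ zk : ℕ → E n, Tendsto zk atTop (𝓝 z) ∧ ∀ᶠ k in atTop, uk k (zk k) ≤ s := by
  obtain ⟨zk, hzk, hlim⟩ := (h z).2
  refine ⟨zk, hzk, ?_⟩
  have h1 : limsup (fun k => uk k (zk k)) atTop < (s : EReal) :=
    (hlim.trans hz).trans_lt (EReal.coe_lt_coe_iff.2 hts)
  exact (eventually_lt_of_limsup_lt h1).mono fun _ hk => hk.le

theorem eventually_forall_mem_of_isCompact {P : ℕ → E n → Prop} {K : Set (E n)} (hK : IsCompact K)
    (h : ∀ x ∈ K, ∀ᶠ p in atTop ×ˢ 𝓝 x, P p.1 p.2) : ∀ᶠ k in atTop, ∀ x ∈ K, P k x := by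
  refine hK.induction_on (p := fun s => ∀ᶠ k in atTop, ∀ x ∈ s, P k x) (by simp)
    (fun s t hst ht => ht.mono fun k hk x hx => hk x (hst hx))
    (fun s t hs ht => ?_) fun x hx => ?_
  · filter_upwards [hs, ht] with k h1 h2 x hx
    exact hx.elim (h1 x) (h2 x)
  · obtain ⟨pa, hpa, pb, hpb, hP⟩ := eventually_prod_iff.1 (h x hx)
    exact ⟨{y | pb y}, mem_nhdsWithin_of_mem_nhds hpb, hpa.mono fun k hk y hy => hP hk hy⟩

theorem eventually_forall_of_local {P : ℕ → E n → Prop} {R : ℝ}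
    (h : ∀ x, ∀ᶠ p in atTop ×ˢ 𝓝 x, P p.1 p.2)
    (hinf : ∀ᶠ k in atTop, ∀ x, R ≤ ‖x‖ → P k x) : ∀ᶠ k in atTop, ∀ x, P k x := by
  filter_upwards [hinf,
    eventually_forall_mem_of_isCompact (isCompact_closedBall (0 : E n) R) fun x _ => h x]
    with k h1 h2 x
  rcases le_total R ‖x‖ with hx | hx
  · exact h1 x hx
  · exact h2 x (by simpa using hx)

/-! ### From epi-convergence to convergence in `delta` -/

theorem SuperCoercive.exists_lt (hu : SuperCoercive u) (C : ℝ) :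
    ∃ R : ℝ, ∀ x, R ≤ ‖x‖ → ((C * ‖x‖ : ℝ) : EReal) < u x := by
  unfold SuperCoercive at hu
  rw [comap_norm_atTop, EReal.tendsto_nhds_top_iff_real] at hu
  obtain ⟨R, -, hR⟩ := hasBasis_cobounded_norm.eventually_iff.1 (hu C)
  refine ⟨max R 1, fun x hx => ?_⟩
  have hpos : 0 < ‖x‖ := one_pos.trans_le ((le_max_right _ _).trans hx)
  have h1 := hR (show R ≤ ‖x‖ from (le_max_left _ _).trans hx)
  rwa [EReal.lt_div_iff (by exact_mod_cast hpos) (EReal.coe_ne_top _), ← EReal.coe_mul] at h1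

/-- Strict form at the point `x` of the inequality `u ≥ v □ (|·| / r - r)`. -/
def StrictlyMajorizesAt (r : ℝ) (u v : E n → EReal) (x : E n) : Prop :=
  ∃ (z : E n) (t b : ℝ), v z ≤ t ∧ t + r⁻¹ * ‖x - z‖ < b + r ∧ (b : EReal) < u x

theorem Majorizes.of_strictly (h : ∀ x, StrictlyMajorizesAt r u v x) : Majorizes r u v := by
  intro x s hs ε hε
  obtain ⟨z, t, b, hz, ht, hb⟩ := h x
  have := EReal.coe_lt_coe_iff.1 (hb.trans_le hs)
  exact ⟨z, t, hz, by linarith⟩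

theorem IsConv.strictlyMajorizesAt (hu : IsConv u) (hr : 0 < r) (x : E n) :
    StrictlyMajorizesAt r u u x := by
  by_cases hx : u x = ⊤
  · obtain ⟨a, t, ha⟩ := hu.exists_le_coe
    exact ⟨a, t, t + r⁻¹ * ‖x - a‖, ha, by linarith, hx ▸ EReal.coe_lt_top _⟩
  · have hxa : u x = (u x).toReal := (EReal.coe_toReal hx (hu.ne_bot x)).symm
    refine ⟨x, (u x).toReal, (u x).toReal - r / 2, hxa.le, by simp; linarith, ?_⟩
    rw [hxa, EReal.coe_lt_coe_iff, EReal.toReal_coe]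
    linarith

/-- Epi-convergence controls `uk k` only on compact sets. Super-coercivity of `u` makes `uk k` large
on a compact annulus, and convexity of `uk k` carries this outward as linear growth of slope `r⁻¹ +
1`, uniformly in `k`. -/
theorem eventually_majorizes_limit (huk : ∀ k, IsConv (uk k)) (hu : u ∈ ConvS n)
    (h : EpiTendsto uk u) (hr : 0 < r) : ∀ᶠ k in atTop, Majorizes r (uk k) u := by
  have hr' : 0 < r⁻¹ := inv_pos.2 hr
  obtain ⟨a, t, ha⟩ := hu.1.exists_le_coe
  obtain ⟨ak, hak, hakt⟩ := exists_recovery_of_epiTendsto h ha (lt_add_one t)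
  obtain ⟨R, hR⟩ := hu.2.exists_lt (r⁻¹ + 2)
  set B := (r⁻¹ + 2) * (‖a‖ + 1) with hB
  have hB' : r⁻¹ ≤ B := by nlinarith [norm_nonneg a, mul_nonneg hr'.le (norm_nonneg a)]
  set S := |R| + ‖a‖ + 1 + |t + 1| + B with hS
  have hSB : B ≤ S := by
    have h1 := abs_nonneg R
    have h2 := abs_nonneg (t + 1)
    have h3 := norm_nonneg a
    linarith
  have hSpos : 0 < S := hr'.trans_le (hB'.trans hSB)
  set M := t + 1 + (r⁻¹ + 1) * S with hM
  -- This annulus contains every sphere of radius `S` about a point within distance 1 of `a`, hence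
  -- about `ak k` for large `k`.
  have hK : IsCompact (Metric.closedBall (0 : E n) (S + ‖a‖ + 1) ∩ {y | S - ‖a‖ - 1 ≤ ‖y‖}) :=
    (isCompact_closedBall _ _).inter_right (isClosed_le continuous_const continuous_norm)
  have hann : ∀ᶠ k in atTop, ∀ y ∈ Metric.closedBall (0 : E n) (S + ‖a‖ + 1) ∩
      {y | S - ‖a‖ - 1 ≤ ‖y‖}, (M : EReal) < uk k y := by
    refine eventually_forall_mem_of_isCompact hK fun y hy => ?_
    refine eventually_prod_lt_of_epiTendsto h (lt_trans ?_ (hR y ?_))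
    · have h1 : (r⁻¹ + 2) * (S - ‖a‖ - 1) ≤ (r⁻¹ + 2) * ‖y‖ := by gcongr; exact hy.2
      rw [EReal.coe_lt_coe_iff]
      have h2 := le_abs_self (t + 1)
      have h3 := abs_nonneg R
      have h4 := norm_nonneg a
      linarith
    · have h1 : S - ‖a‖ - 1 ≤ ‖y‖ := hy.2
      have h2 := abs_nonneg (t + 1)
      have h3 := le_abs_self R
      linarith
  have hfar : ∀ᶠ k in atTop, ∀ x, S + ‖a‖ + 1 ≤ ‖x‖ → StrictlyMajorizesAt r (uk k) u x := by
    filter_upwards [hann, hakt, Metric.tendsto_nhds.1 hak 1 one_pos] with k h1 h2 h3 x hx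
    have hak1 : ‖ak k‖ ≤ ‖a‖ + 1 := by
      rw [dist_eq_norm] at h3
      have := norm_le_norm_add_norm_sub' (ak k) a
      linarith
    have hxk : S ≤ ‖x - ak k‖ := by
      have := norm_sub_norm_le x (ak k)
      linarith
    refine ⟨a, t, t + 1 / 2 + (r⁻¹ + 1) * ‖x - ak k‖, ha, ?_, ?_⟩
    · have h4 : ‖x - a‖ ≤ ‖x - ak k‖ + 1 := by
        have := norm_sub_le_norm_sub_add_norm_sub x (ak k) a
        rw [dist_eq_norm] at h3
        linarith
      have h5 : r⁻¹ * ‖x - a‖ ≤ r⁻¹ * (‖x - ak k‖ + 1) := by gcongr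
      linarith
    · by_contra! hle
      have h4 := (huk k).le_of_le_on_sphere (M := M) hSpos h2 (fun y hy => (h1 y ⟨?_, ?_⟩).le)
        hxk hle
      · rw [hM, add_sub_cancel_left, mul_div_cancel_right₀ _ hSpos.ne'] at h4
        linarith
      · have := norm_le_norm_add_norm_sub' y (ak k)
        rw [mem_closedBall_zero_iff]
        linarith
      · have := norm_sub_le y (ak k)
        show S - ‖a‖ - 1 ≤ ‖y‖
        linarith
  refine (eventually_forall_of_local (fun x => ?_) hfar).mono fun k hk => Majorizes.of_strictly hk
  obtain ⟨z, s, b, hz, hs, hb⟩ := hu.1.strictlyMajorizesAt hr x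
  have hcont : Tendsto (fun p : ℕ × E n => s + r⁻¹ * ‖p.2 - z‖) (atTop ×ˢ 𝓝 x)
      (𝓝 (s + r⁻¹ * ‖x - z‖)) :=
    ((tendsto_snd.sub_const z).norm.const_mul _).const_add _
  filter_upwards [eventually_prod_lt_of_epiTendsto h hb, hcont.eventually (gt_mem_nhds hs)]
    with p h1 h2
  exact ⟨z, s, b, hz, h2, h1⟩

/-- Far out, the superlinear growth of the fixed function `u` beats the cone at the recovery point
`ak k`; locally, recovery sequences supply the matching points and lower semicontinuity of `u` keeps
the bound `b`. -/
theorem eventually_limit_majorizes (hu : u ∈ ConvS n) (h : EpiTendsto uk u) (hr : 0 < r) :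
    ∀ᶠ k in atTop, Majorizes r u (uk k) := by
  have hr' : 0 < r⁻¹ := inv_pos.2 hr
  obtain ⟨a, t, ha⟩ := hu.1.exists_le_coe
  obtain ⟨ak, hak, hakt⟩ := exists_recovery_of_epiTendsto h ha (lt_add_one t)
  obtain ⟨R, hR⟩ := hu.2.exists_lt (r⁻¹ + 1)
  have hfar : ∀ᶠ k in atTop, ∀ x, max R (t + 1 + r⁻¹ * (‖a‖ + 1)) ≤ ‖x‖ →
      StrictlyMajorizesAt r u (uk k) x := by
    filter_upwards [hakt, Metric.tendsto_nhds.1 hak 1 one_pos] with k h2 h3 x hx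
    refine ⟨ak k, t + 1, (r⁻¹ + 1) * ‖x‖, h2, ?_, hR x ((le_max_left _ _).trans hx)⟩
    have h4 : t + 1 + r⁻¹ * (‖a‖ + 1) ≤ ‖x‖ := (le_max_right _ _).trans hx
    have h5 : ‖x - ak k‖ ≤ ‖x‖ + (‖a‖ + 1) := by
      rw [dist_eq_norm] at h3
      have := norm_le_norm_add_norm_sub' (ak k) a
      have := norm_sub_le x (ak k)
      linarith
    have h6 : r⁻¹ * ‖x - ak k‖ ≤ r⁻¹ * (‖x‖ + (‖a‖ + 1)) := by gcongr
    linarith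
  refine (eventually_forall_of_local (fun x => ?_) hfar).mono fun k hk => Majorizes.of_strictly hk
  obtain ⟨z, s, b, hz, hs, hb⟩ := hu.1.strictlyMajorizesAt hr x
  obtain ⟨s', hss', hs'⟩ := exists_between (show s < b + r - r⁻¹ * ‖x - z‖ by linarith)
  obtain ⟨zk, hzk, hzks⟩ := exists_recovery_of_epiTendsto h hz hss'
  have hcont : Tendsto (fun p : ℕ × E n => s' + r⁻¹ * ‖p.2 - zk p.1‖) (atTop ×ˢ 𝓝 x)
      (𝓝 (s' + r⁻¹ * ‖x - z‖)) :=
    ((tendsto_snd.sub (hzk.comp tendsto_fst)).norm.const_mul _).const_add _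
  filter_upwards [tendsto_fst.eventually hzks, tendsto_snd.eventually (hu.1.lsc x b hb),
    hcont.eventually (gt_mem_nhds (by linarith : s' + r⁻¹ * ‖x - z‖ < b + r))] with p h1 h2 h3
  exact ⟨zk p.1, s', b, h1, h3, h2⟩

theorem tendsto_delta_of_epiTendsto (huk : ∀ k, IsConv (uk k)) (hu : u ∈ ConvS n)
    (h : EpiTendsto uk u) : Tendsto (fun k => delta (uk k) u) atTop (𝓝 0) := by
  refine ENNReal.tendsto_nhds_zero.2 fun ε hε => ?_
  obtain ⟨r, hr, hrε⟩ := ENNReal.lt_iff_exists_nnreal_btwn.1 hε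
  have hr' : (0 : ℝ) < r := by exact_mod_cast hr
  filter_upwards [eventually_majorizes_limit huk hu h hr', eventually_limit_majorizes hu h hr']
    with k h1 h2
  exact (delta_le hr' h1 h2).trans (by simpa using hrε.le)

end ConvexFunctionMetric

theorem mainTheorem5 (n : ℕ) :
    -- the description of `delta` through the conjugate functions
    (∀ u ∈ ConvexFunctionMetric.ConvC n, ∀ v ∈ ConvexFunctionMetric.ConvC n,
      ConvexFunctionMetric.delta u v =
        (⨅ (r : ℝ) (_ : 0 < r)
          (_ : (∀ y, ConvexFunctionMetric.conj u y ≤ ConvexFunctionMetric.conj v y +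
                ConvexFunctionMetric.indicatorTop (Metric.closedBall 0 (1 / r)) y + (r : EReal)) ∧
              (∀ y, ConvexFunctionMetric.conj v y ≤ ConvexFunctionMetric.conj u y +
                ConvexFunctionMetric.indicatorTop (Metric.closedBall 0 (1 / r)) y + (r : EReal))),
          ENNReal.ofReal r) ∧
      ConvexFunctionMetric.delta u v =
        (⨅ (r : ℝ) (_ : 0 < r)
          (_ : ConvexFunctionMetric.supDist (Metric.closedBall 0 (1 / r))
            (ConvexFunctionMetric.conj u) (ConvexFunctionMetric.conj v) ≤ ENNReal.ofReal r),
          ENNReal.ofReal r)) ∧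
    -- `delta` is a finite metric
    (∀ u ∈ ConvexFunctionMetric.ConvC n, ∀ v ∈ ConvexFunctionMetric.ConvC n,
      ConvexFunctionMetric.delta u v ≠ ⊤) ∧
    (∀ u ∈ ConvexFunctionMetric.ConvC n, ∀ v ∈ ConvexFunctionMetric.ConvC n,
      (ConvexFunctionMetric.delta u v = 0 ↔ u = v)) ∧
    (∀ u ∈ ConvexFunctionMetric.ConvC n, ∀ v ∈ ConvexFunctionMetric.ConvC n,
      ConvexFunctionMetric.delta u v = ConvexFunctionMetric.delta v u) ∧
    (∀ u ∈ ConvexFunctionMetric.ConvC n, ∀ v ∈ ConvexFunctionMetric.ConvC n,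
      ∀ w ∈ ConvexFunctionMetric.ConvC n,
      ConvexFunctionMetric.delta u v ≤
        ConvexFunctionMetric.delta u w + ConvexFunctionMetric.delta w v) ∧
    -- invariance under joint translations of epigraphs
    (∀ u ∈ ConvexFunctionMetric.ConvC n, ∀ v ∈ ConvexFunctionMetric.ConvC n,
      ∀ (x₀ : ConvexFunctionMetric.E n) (t₀ : ℝ),
      ConvexFunctionMetric.translate x₀ t₀ u ∈ ConvexFunctionMetric.ConvC n ∧
      ConvexFunctionMetric.translate x₀ t₀ v ∈ ConvexFunctionMetric.ConvC n ∧
      ConvexFunctionMetric.delta u v =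
        ConvexFunctionMetric.delta (ConvexFunctionMetric.translate x₀ t₀ u)
          (ConvexFunctionMetric.translate x₀ t₀ v)) ∧
    -- convergence in `delta` implies epi-convergence
    (∀ uk : ℕ → ConvexFunctionMetric.E n → EReal, (∀ k, uk k ∈ ConvexFunctionMetric.ConvC n) →
      ∀ u ∈ ConvexFunctionMetric.ConvC n,
      Filter.Tendsto (fun k => ConvexFunctionMetric.delta (uk k) u) Filter.atTop (nhds 0) →
      ConvexFunctionMetric.EpiTendsto uk u) ∧
    -- for super-coercive functions epi-convergence implies convergence in `delta`
    (∀ uk : ℕ → ConvexFunctionMetric.E n → EReal, (∀ k, uk k ∈ ConvexFunctionMetric.ConvS n) →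
      ∀ u ∈ ConvexFunctionMetric.ConvS n,
      ConvexFunctionMetric.EpiTendsto uk u →
      Filter.Tendsto (fun k => ConvexFunctionMetric.delta (uk k) u) Filter.atTop (nhds 0)) := by
  open ConvexFunctionMetric in
  exact ⟨fun u hu v hv => ⟨delta_eq_iInf_conj_le hu.1 hv.1, delta_eq_iInf_supDist_le hu.1 hv.1⟩,
    fun u hu v hv => delta_ne_top hu hv,
    fun u hu v hv => delta_eq_zero_iff hu hv,
    fun u _ v _ => delta_comm u v,
    fun u _ v _ w _ => delta_triangle u v w,
    fun u hu v hv x₀ t₀ => ⟨translate_mem_convC hu x₀ t₀, translate_mem_convC hv x₀ t₀,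
      (delta_translate x₀ t₀ u v).symm⟩,
    fun uk huk u hu h => epiTendsto_of_tendsto_delta huk hu h,
    fun uk huk u hu h => tendsto_delta_of_epiTendsto (fun k => (huk k).1) hu h⟩
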